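/- Let $t\ge 1$, $k\ge 2t$ and $v\ge k$ be integers, let $X$ be a $v$-set, $n=\binom vt$, and index matrices by the $t$-subsets of $X$. Put $\xi_i=\binom{v-t-i}{k-t-i}$ for $0\le i\le t$ and $M(T,U)=\xi_{|T\setminus U|}$ (the number of $k$-subsets of $X$ containing $T\cup U$). Fix a $t$-subset $T_0$ of $X$, let $B$ be the $n\times n$ identity matrix with its column $T_0$ replaced by the all-ones vector, and let $M_1=MB$. Let $A_0,\dots,A_t$ be the adjacency matrices of the Johnson scheme ($A_i(S,T)=1$ if $|S\cap T|=t-i$, and $0$ otherwise), let $$P_{ij}=\sum_{s=0}^i(-1)^{i-s}\binom{t-s}{i-s}\binom{t-j}{s}\binom{v-t+s-j}{s},\qquad \theta_j=\sum_{i=0}^t\xi_iP_{ij},\qquad m_j=\binom vj-\binom v{j-1}\qquad(0\le i,j\le t),$$ and let $E_j$ be the orthogonal projection onto $\{x\in\mathbb R^n : A_ix=P_{ij}x \text{ for } 0\le i\le t\}$. Let $e^{(j)}$ be the unit vector in the direction of the column $T_0$ of $E_j$, let $V=[e^{(0)}\ \cdots\ e^{(t)}]$, $\Theta=\operatorname{diag}(\theta_0,\dots,\theta_t)$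 and $R=V^\top MBV$. (1) For all $v\ge k$ and all $T_0$, the characteristic polynomial of $M_1$ is $$\chi_{M_1}(x)=\chi_R(x)\prod_{j=1}^t(x-\theta_j)^{m_j-1},$$ and $R$ is a rank-one perturbation of $\Theta$: $\operatorname{rank}(R-\Theta)=1$ and $R=\Theta\,(I+\mathbf u\,\mathbf w^\top)$, where $\mathbf u_i=\delta_{i0}-\sqrt{m_i}/n$ and $\mathbf w_j=\sqrt{m_j}$ for $0\le i,j\le t$. (2) There are $v_0$ and $c,c'>0$, depending only on $t$ and $k$, such that for all $v\ge\max(v_0,k)$ and all $T_0$: the matrix $R$ has $t+1$ distinct real eigenvalues, each greater than $\theta_t/2$; and every complex eigenvalue $\lambda$ of $M_1$ is real, with $\lambda>\theta_t/2$ and $c\,v^{k-t}\le\lambda\le c'\,v^{k-t}$. -/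

import Mathlib

open Polynomial

namespace JohnsonCoverage

/-- The `t`-subsets of the `v`-set `{0, …, v-1}`. -/
abbrev TSet (v t : ℕ) : Type := {T : Finset (Fin v) // T.card = t}

/-- `ξ_i`, the number of `k`-subsets of a `v`-set that contain a given set of size `t + i`.
It is used for `i ≤ t`, `2 * t ≤ k ≤ v`, where no subtraction truncates. -/
def xi (v t k i : ℕ) : ℕ := (v - t - i).choose (k - t - i)

/-- The coverage matrix: its `(T, U)` entry is the number of `k`-subsets containing `T ∪ U`. -/
def covM (v t k : ℕ) : Matrix (TSet v t) (TSet v t) ℝ :=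
  Matrix.of fun T U => (xi v t k (T.1 \ U.1).card : ℝ)

/-- The matrix `B`: the identity, with the column of the `t`-set `T₀` (the "first" one)
replaced by the all-ones vector. -/
def matB {v t : ℕ} (T₀ : TSet v t) : Matrix (TSet v t) (TSet v t) ℝ :=
  Matrix.of fun S T => if T = T₀ then 1 else if S = T then 1 else 0

/-- `M₁ = M B`. -/
noncomputable def covM₁ {v t : ℕ} (k : ℕ) (T₀ : TSet v t) : Matrix (TSet v t) (TSet v t) ℝ :=
  covM v t k * matB T₀

/-- The adjacency matrices of the Johnson scheme: `S` and `T` are `i`-th associates iff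
`|S ∩ T| = t - i`, that is, `|S ∩ T| + i = t`. -/
def johnsonA (v t i : ℕ) : Matrix (TSet v t) (TSet v t) ℝ :=
  Matrix.of fun S T => if (S.1 ∩ T.1).card + i = t then 1 else 0

/-- The entries `P_{ij}` of the first eigenmatrix of the Johnson scheme. It is used for
`i, j ≤ t` and `2 * t ≤ v`, where no subtraction truncates. -/
def johnsonP (v t i j : ℕ) : ℝ :=
  ∑ s ∈ Finset.range (i + 1),
    (-1 : ℝ) ^ (i - s) * ((t - s).choose (i - s) : ℝ) * ((t - j).choose s : ℝ)
      * ((v - t + s - j).choose s : ℝ)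

/-- `θ_j = ∑_{i=0}^t ξ_i P_{ij}`. -/
def theta (v t k j : ℕ) : ℝ :=
  ∑ i ∈ Finset.range (t + 1), (xi v t k i : ℝ) * johnsonP v t i j

/-- `m_j = C(v, j) - C(v, j - 1)`, with `C(v, -1) = 0`. -/
def mult (v : ℕ) : ℕ → ℕ
  | 0 => 1
  | j + 1 => v.choose (j + 1) - v.choose j

/-- The `j`-th common eigenspace of the Johnson scheme: `A_i` acts on it as `P_{ij}`,
for every `i = 0, …, t`. -/
noncomputable def johnsonSpace (v t j : ℕ) : Submodule ℝ (EuclideanSpace ℝ (TSet v t)) :=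
  ⨅ i : Fin (t + 1),
    Module.End.eigenspace (Matrix.toEuclideanLin (johnsonA v t i)) (johnsonP v t i j)

/-- The primitive idempotent `E_j`: the matrix of the orthogonal projection onto the
`j`-th common eigenspace. -/
noncomputable def johnsonE (v t j : ℕ) : Matrix (TSet v t) (TSet v t) ℝ :=
  Matrix.of fun S T => (johnsonSpace v t j).starProjection (EuclideanSpace.single T 1) S

/-- The unit vector `e^{(j)}`, the normalized `T₀`-column of `E_j`. -/
noncomputable def unitE {v t : ℕ} (T₀ : TSet v t) (j : ℕ) : EuclideanSpace ℝ (TSet v t) :=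
  ‖WithLp.toLp 2 ((johnsonE v t j).col T₀)‖⁻¹ • WithLp.toLp 2 ((johnsonE v t j).col T₀)

/-- The matrix with columns `e^{(0)}, …, e^{(t)}`. -/
noncomputable def matV {v t : ℕ} (T₀ : TSet v t) : Matrix (TSet v t) (Fin (t + 1)) ℝ :=
  Matrix.of fun S j => unitE T₀ j S

/-- `R = Vᵀ M B V`. -/
noncomputable def matR {v t : ℕ} (k : ℕ) (T₀ : TSet v t) :
    Matrix (Fin (t + 1)) (Fin (t + 1)) ℝ :=
  (matV T₀).transpose * covM v t k * matB T₀ * matV T₀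

/-- `Θ = diag(θ_0, …, θ_t)`. -/
def matTheta (v t k : ℕ) : Matrix (Fin (t + 1)) (Fin (t + 1)) ℝ :=
  Matrix.diagonal fun j => theta v t k j

end JohnsonCoverage

/-! A function on `j`-sets is harmonic if its sum over the `j`-sets containing `Z` vanishes whenever
`|Z| < j`. Lifted to `t`-sets by subset sums, it becomes a common eigenvector of all `A_i`, with
eigenvalues `P_{ij}` (`johnsonA_mulVec_liftT`). The lift is injective, so the `j`-th common
eigenspace has dimension at least `m_j`. These spaces are orthogonal and `∑ m_j = n`, so they fill
`ℝ^n` with dimensions exactly `m_j`. Since `M` counts `k`-sets containing both `T` and `U`, applying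
it to a lift also gives `θ_j = C(k-j, t-j) C(v-t-j, k-t)` (`theta_eq`), hence positivity, strict
decrease in `j` and order `v^(k-t)` for large `v`.

`M₁` is `M` plus a rank-one matrix. By transitivity on `t`-sets, `E_j` has constant diagonal `m_j /
n`. The matrix determinant lemma then gives `M₁` and `R` the same secular factor `1 - ∑ (δ_{j0} -
m_j/n) θ_j / (x - θ_j)`, whence the factorization of `χ_{M₁}`. Finally `χ_R` alternates in sign at
`2θ_0 > θ_1 > ⋯ > θ_t > θ_t/2`, which locates its `t + 1` roots (`exists_roots_of_secular`). -/

namespace JohnsonCoverage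

/-! ### Harmonic functions and their subset sums. -/

section Harmonic

variable {α : Type*} [DecidableEq α]

/-- The sum of `y` over the `j`-subsets of `A`. -/
def subsetSum (j : ℕ) (y : Finset α → ℝ) (A : Finset α) : ℝ :=
  ∑ S ∈ A.powersetCard j, y S

/-- `y` is harmonic of degree `j`: its sum over the `j`-sets containing `Z` vanishes for every
set `Z` of size less than `j`. -/
def IsHarmonic [Fintype α] (j : ℕ) (y : Finset α → ℝ) : Prop :=
  ∀ Z : Finset α, Z.card < j → ∑ S ∈ Finset.univ.powersetCard j with Z ⊆ S, y S = 0

lemma card_powersetCard_superset {A S : Finset α} (hSA : S ⊆ A) {s : ℕ} (hs : s ≤ A.card) :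
    ((A.powersetCard s).filter (S ⊆ ·)).card = (A.card - S.card).choose (A.card - s) := by
  have hSc := Finset.card_le_card hSA
  rcases le_or_gt S.card s with h | h
  · rw [Finset.card_filter_powersetCard_subset S A s hSA h, ← Nat.choose_symm (by omega)]
    congr 1
    omega
  · rw [Nat.choose_eq_zero_of_lt (by omega), Finset.card_eq_zero, Finset.filter_eq_empty_iff]
    intro Z hZ hSZ
    have := Finset.card_le_card hSZ
    rw [Finset.mem_powersetCard] at hZ
    omega

lemma card_powersetCard_subset (A S : Finset α) (i : ℕ) :
    ((A.powersetCard i).filter (· ⊆ S)).card = (S ∩ A).card.choose i := by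
  rw [← Finset.card_powersetCard]
  congr 1
  ext Z
  simp only [Finset.mem_filter, Finset.mem_powersetCard, Finset.subset_inter_iff]
  tauto

/-- Summing subset sums over the `s`-subsets of `A`. -/
lemma sum_subsetSum_subsets (j s : ℕ) (y : Finset α → ℝ) (A : Finset α) (hs : s ≤ A.card) :
    ∑ Z ∈ A.powersetCard s, subsetSum j y Z
      = ((A.card - j).choose (A.card - s) : ℝ) * subsetSum j y A := by
  unfold subsetSum
  rw [Finset.sum_comm' (t' := A.powersetCard j)
    (s' := fun S => (A.powersetCard s).filter (S ⊆ ·)), Finset.mul_sum]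
  · refine Finset.sum_congr rfl fun S hS => ?_
    rw [Finset.mem_powersetCard] at hS
    rw [Finset.sum_const, card_powersetCard_superset hS.1 hs, hS.2, nsmul_eq_mul]
  · intro Z S
    simp only [Finset.mem_filter, Finset.mem_powersetCard]
    exact ⟨fun h => ⟨⟨h.1, h.2.1⟩, h.2.1.trans h.1.1, h.2.2⟩, fun h => ⟨h.1.1, h.1.2, h.2.2⟩⟩

variable [Fintype α]

lemma card_supersets (S : Finset α) {r : ℕ} (hr : r ≤ Fintype.card α) :
    (((Finset.univ : Finset α).powersetCard r).filter (S ⊆ ·)).card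
      = (Fintype.card α - S.card).choose (Fintype.card α - r) := by
  simpa [Finset.card_univ] using
    card_powersetCard_superset (Finset.subset_univ S) (s := r) (by simpa using hr)

/-- The binomial counts the `i`-sets `I ⊆ S ∩ A`; exchange the sums. Harmonicity kills `i < j`, no
`S` contains `I` if `i > j`, and only `S = I` remains if `i = j`. -/
lemma IsHarmonic.sum_choose {j : ℕ} {y : Finset α → ℝ} (hy : IsHarmonic j y) (A : Finset α)
    (i : ℕ) :
    ∑ S ∈ Finset.univ.powersetCard j, ((S ∩ A).card.choose i : ℝ) * y S
      = if i = j then subsetSum j y A else 0 := by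
  have h1 : ∑ S ∈ Finset.univ.powersetCard j, ((S ∩ A).card.choose i : ℝ) * y S
      = ∑ I ∈ A.powersetCard i, ∑ S ∈ Finset.univ.powersetCard j with I ⊆ S, y S := by
    rw [Finset.sum_comm' (t' := Finset.univ.powersetCard j)
      (s' := fun S => (A.powersetCard i).filter (· ⊆ S))]
    · refine Finset.sum_congr rfl fun S _ => ?_
      rw [Finset.sum_const, card_powersetCard_subset, nsmul_eq_mul]
    · intro Z S
      simp only [Finset.mem_filter]
      tauto
  rw [h1]
  split_ifs with h
  · subst h
    refine Finset.sum_congr rfl fun I hI => ?_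
    rw [Finset.mem_powersetCard] at hI
    rw [Finset.sum_eq_single I]
    · intro S hS hSI
      simp only [Finset.mem_filter, Finset.mem_powersetCard] at hS
      exact absurd (Finset.eq_of_subset_of_card_le hS.2 (by omega)).symm hSI
    · intro h
      exact absurd (by simp [hI.2]) h
  · refine Finset.sum_eq_zero fun I hI => ?_
    rw [Finset.mem_powersetCard] at hI
    rcases lt_or_gt_of_ne h with h | h
    · exact hy I (by omega)
    · refine Finset.sum_eq_zero fun S hS => ?_
      simp only [Finset.mem_filter, Finset.mem_powersetCard] at hS
      have := Finset.card_le_card hS.2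
      omega

/-- Summing the subset sums of a harmonic function over the `r`-sets containing `A`. -/
lemma IsHarmonic.sum_subsetSum_supersets {j r : ℕ} {y : Finset α → ℝ} (hy : IsHarmonic j y)
    (A : Finset α) (hAj : A.card + j ≤ Fintype.card α) (hr : r ≤ Fintype.card α)
    (hAr : A.card ≤ r) :
    ∑ K ∈ Finset.univ.powersetCard r with A ⊆ K, subsetSum j y K
      = ((Fintype.card α - A.card - j).choose (r - A.card) : ℝ) * subsetSum j y A := by
  set v := Fintype.card α with hv
  have h1 : ∑ K ∈ Finset.univ.powersetCard r with A ⊆ K, subsetSum j y K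
      = ∑ S ∈ Finset.univ.powersetCard j,
          (((S ∩ A).card + (v - A.card - j)).choose (v - r) : ℝ) * y S := by
    unfold subsetSum
    rw [Finset.sum_comm' (t' := Finset.univ.powersetCard j)
      (s' := fun S => (Finset.univ.powersetCard r).filter (S ∪ A ⊆ ·))]
    · refine Finset.sum_congr rfl fun S hS => ?_
      rw [Finset.mem_powersetCard] at hS
      rw [Finset.sum_const, card_supersets _ hr, nsmul_eq_mul]
      have := Finset.card_union_add_card_inter S A
      have hle : (S ∩ A).card ≤ S.card := Finset.card_le_card Finset.inter_subset_left
      congr 3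
      omega
    · intro K S
      simp only [Finset.mem_filter, Finset.mem_powersetCard, Finset.union_subset_iff,
        Finset.subset_univ, true_and]
      tauto
  rw [h1]
  -- Vandermonde expands the count in the binomials `C(|S ∩ A|, i)`, of which only `i = j` survives
  -- summation against `y`.
  have h2 : ∀ S : Finset α,
      ((((S ∩ A).card + (v - A.card - j)).choose (v - r) : ℕ) : ℝ)
        = ∑ i ∈ Finset.range (v - r + 1),
          ((v - A.card - j).choose (v - r - i) : ℝ) * ((S ∩ A).card.choose i : ℝ) := by
    intro S
    rw [Nat.add_choose_eq, Finset.Nat.sum_antidiagonal_eq_sum_range_succ_mk]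
    push_cast
    exact Finset.sum_congr rfl fun i _ => mul_comm _ _
  simp_rw [h2, Finset.sum_mul]
  rw [Finset.sum_comm]
  simp_rw [mul_assoc, ← Finset.mul_sum, hy.sum_choose A, mul_ite, mul_zero]
  rw [Finset.sum_ite_eq']
  split_ifs with h
  · rw [Finset.mem_range] at h
    congr 2
    rw [← Nat.choose_symm (by omega)]
    congr 1
    omega
  · rw [Finset.mem_range] at h
    rw [Nat.choose_eq_zero_of_lt (by omega)]
    simp

end Harmonic

/-- Trinomial revision pulls out `C(a, t-i)` and leaves an alternating row sum of binomials. With `a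
= |T ∩ U|` this expresses `A_i` through the matrices `C(|T ∩ U|, t-s)`, the source of the formula
for `P_{ij}`. -/
lemma alternating_choose_sum {t i a : ℕ} (hi : i ≤ t) (ha : a ≤ t) :
    ∑ s ∈ Finset.range (i + 1),
      (-1 : ℝ) ^ (i - s) * ((t - s).choose (i - s) : ℝ) * (a.choose (t - s) : ℝ)
      = if a + i = t then 1 else 0 := by
  have h1 : ∀ s ∈ Finset.range (i + 1),
      (-1 : ℝ) ^ (i - s) * ((t - s).choose (i - s) : ℝ) * (a.choose (t - s) : ℝ)
      = (a.choose (t - i) : ℝ) * ((-1 : ℝ) ^ (i - s) * ((a - (t - i)).choose (i - s) : ℝ)) := by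
    intro s hs
    rw [Finset.mem_range] at hs
    have h := Nat.choose_mul (n := a) (k := t - s) (s := t - i) (by omega)
    rw [show t - s - (t - i) = i - s by omega] at h
    have h' : (t - s).choose (i - s) = (t - s).choose (t - i) := by
      rw [← Nat.choose_symm (by omega)]; congr 1; omega
    rw [h']
    have h'' : (a.choose (t - s) : ℝ) * ((t - s).choose (t - i) : ℝ)
      = (a.choose (t - i) : ℝ) * ((a - (t - i)).choose (i - s) : ℝ) := by exact_mod_cast h
    linear_combination (-1 : ℝ) ^ (i - s) * h''
  rw [Finset.sum_congr rfl h1, ← Finset.mul_sum]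
  have h2 := Finset.sum_range_reflect
    (fun l => (-1 : ℝ) ^ l * ((a - (t - i)).choose l : ℝ)) (i + 1)
  simp only [Nat.add_sub_cancel] at h2
  rw [h2]
  have h3 : ∑ l ∈ Finset.range (i + 1), (-1 : ℝ) ^ l * ((a - (t - i)).choose l : ℝ)
      = ∑ l ∈ Finset.range (a - (t - i) + 1), (-1 : ℝ) ^ l * ((a - (t - i)).choose l : ℝ) := by
    symm
    apply Finset.sum_subset
    · intro x; simp only [Finset.mem_range]; omega
    · intro x _ hx
      simp only [Finset.mem_range] at hx
      rw [Nat.choose_eq_zero_of_lt (by omega)]; simp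
  have h4 := @Int.alternating_sum_range_choose (a - (t - i))
  have h5 : ∑ l ∈ Finset.range (a - (t - i) + 1),
      (-1 : ℝ) ^ l * ((a - (t - i)).choose l : ℝ) = if a - (t - i) = 0 then 1 else 0 := by
    exact_mod_cast congrArg (Int.cast : ℤ → ℝ) h4
  rw [h3, h5]
  rcases lt_trichotomy (a + i) t with h | h | h
  · rw [Nat.choose_eq_zero_of_lt (by omega), if_neg h.ne]; simp
  · rw [if_pos h, if_pos (by omega), show t - i = a by omega]; simp
  · rw [if_neg h.ne', if_neg (by omega)]; simp

/-! ### Lifted harmonic functions as eigenvectors of `A_i` and `M`. -/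

section Action

variable {v t j : ℕ}

lemma sum_tset (f : Finset (Fin v) → ℝ) :
    ∑ S : TSet v t, f S.1 = ∑ S ∈ Finset.univ.powersetCard t, f S := by
  rw [Finset.sum_subtype (p := fun S : Finset (Fin v) => S.card = t) (F := inferInstance)]
  simp [Finset.mem_powersetCard]

/-- A harmonic function, extended to the `t`-sets by subset sums. -/
def liftT (v t j : ℕ) (y : Finset (Fin v) → ℝ) : TSet v t → ℝ := fun T => subsetSum j y T.1

/-- The kernel counts the `(t-s)`-sets `Z ⊆ T ∩ U`: sum over `U ⊇ Z` by harmonicity, then over `Z ⊆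
T`. Each stage contributes one binomial. -/
lemma sum_choose_inter_mul_liftT {y : Finset (Fin v) → ℝ} (hy : IsHarmonic j y)
    (hv : 2 * t ≤ v) (hj : j ≤ t) {s : ℕ} (hs : s ≤ t) (T : TSet v t) :
    ∑ U : TSet v t, ((T.1 ∩ U.1).card.choose (t - s) : ℝ) * liftT v t j y U
      = ((t - j).choose s : ℝ) * ((v - t + s - j).choose s : ℝ) * liftT v t j y T := by
  unfold liftT
  rw [sum_tset (fun U => ((T.1 ∩ U).card.choose (t - s) : ℝ) * subsetSum j y U)]
  have h1 : ∑ U ∈ Finset.univ.powersetCard t, ((T.1 ∩ U).card.choose (t - s) : ℝ) * subsetSum j y U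
      = ∑ Z ∈ T.1.powersetCard (t - s),
          ∑ U ∈ Finset.univ.powersetCard t with Z ⊆ U, subsetSum j y U := by
    rw [Finset.sum_comm' (t' := Finset.univ.powersetCard t)
      (s' := fun U => (T.1.powersetCard (t - s)).filter (· ⊆ U))]
    · refine Finset.sum_congr rfl fun S _ => ?_
      rw [Finset.sum_const, card_powersetCard_subset, nsmul_eq_mul, Finset.inter_comm]
    · intro Z S
      simp only [Finset.mem_filter]
      tauto
  rw [h1]
  have h2 : ∀ Z ∈ T.1.powersetCard (t - s),
      ∑ U ∈ Finset.univ.powersetCard t with Z ⊆ U, subsetSum j y U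
        = ((v - t + s - j).choose s : ℝ) * subsetSum j y Z := by
    intro Z hZ
    rw [Finset.mem_powersetCard] at hZ
    rw [hy.sum_subsetSum_supersets Z (by simp; omega) (by simp; omega) (by omega), hZ.2]
    simp only [Fintype.card_fin]
    congr 3 <;> omega
  rw [Finset.sum_congr rfl h2, ← Finset.mul_sum, sum_subsetSum_subsets _ _ _ _ (by rw [T.2]; omega),
    T.2, show t - (t - s) = s by omega]
  ring

lemma johnsonA_mulVec_liftT {y : Finset (Fin v) → ℝ} (hy : IsHarmonic j y)
    (hv : 2 * t ≤ v) (hj : j ≤ t) {i : ℕ} (hi : i ≤ t) :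
    (johnsonA v t i).mulVec (liftT v t j y) = johnsonP v t i j • liftT v t j y := by
  ext T
  have hA : ∀ U : TSet v t, johnsonA v t i T U = ∑ s ∈ Finset.range (i + 1),
      (-1 : ℝ) ^ (i - s) * ((t - s).choose (i - s) : ℝ) * ((T.1 ∩ U.1).card.choose (t - s) : ℝ) := by
    intro U
    rw [alternating_choose_sum hi]
    · rfl
    · exact (Finset.card_le_card Finset.inter_subset_left).trans T.2.le
  simp only [Matrix.mulVec, dotProduct, hA, Finset.sum_mul, Pi.smul_apply, smul_eq_mul, johnsonP]
  rw [Finset.sum_comm]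
  refine Finset.sum_congr rfl fun s hs => ?_
  rw [Finset.mem_range] at hs
  simp_rw [mul_assoc, ← Finset.mul_sum]
  rw [sum_choose_inter_mul_liftT hy hv hj (by omega)]
  ring

lemma covM_apply {k : ℕ} (hk : 2 * t ≤ k) (hv : k ≤ v) (T U : TSet v t) :
    covM v t k T U = (((Finset.univ.powersetCard k).filter (T.1 ∪ U.1 ⊆ ·)).card : ℝ) := by
  rw [card_supersets _ (by simpa using hv)]
  have h1 : (T.1 \ U.1).card ≤ t := (Finset.card_le_card Finset.sdiff_subset).trans T.2.le
  have h2 : (T.1 ∪ U.1).card = t + (T.1 \ U.1).card := by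
    rw [← Finset.sdiff_union_self_eq_union, Finset.card_union_of_disjoint Finset.sdiff_disjoint, U.2,
      add_comm]
  rw [h2]
  simp only [covM, xi, Matrix.of_apply, Fintype.card_fin]
  rw [← Nat.choose_symm (by omega)]
  congr 2 <;> omega

/-- `M` factors through the `k`-sets: sum down from `K` to its `t`-subsets, then over the `K ⊇ T`.
This yields the eigenvalue as a product with no alternating signs. -/
lemma covM_mulVec_liftT {k : ℕ} (hk : 2 * t ≤ k) (hv : k ≤ v)
    {y : Finset (Fin v) → ℝ} (hy : IsHarmonic j y) (hj : j ≤ t) :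
    (covM v t k).mulVec (liftT v t j y)
      = (((k - j).choose (t - j) : ℝ) * ((v - t - j).choose (k - t) : ℝ)) • liftT v t j y := by
  ext T
  simp only [Matrix.mulVec, dotProduct, covM_apply hk hv, Pi.smul_apply, smul_eq_mul, liftT]
  rw [sum_tset (fun U => (((Finset.univ.powersetCard k).filter (T.1 ∪ U ⊆ ·)).card : ℝ)
    * subsetSum j y U)]
  have h1 : ∑ U ∈ Finset.univ.powersetCard t,
        (((Finset.univ.powersetCard k).filter (T.1 ∪ U ⊆ ·)).card : ℝ) * subsetSum j y U
      = ∑ K ∈ Finset.univ.powersetCard k with T.1 ⊆ K,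
          ∑ U ∈ K.powersetCard t, subsetSum j y U := by
    rw [Finset.sum_comm' (t' := Finset.univ.powersetCard t)
      (s' := fun U => (Finset.univ.powersetCard k).filter (T.1 ∪ U ⊆ ·))]
    · refine Finset.sum_congr rfl fun S _ => ?_
      rw [Finset.sum_const, nsmul_eq_mul]
    · intro K U
      simp only [Finset.mem_filter, Finset.mem_powersetCard, Finset.union_subset_iff,
        Finset.subset_univ, true_and]
      tauto
  have h2 : ∀ K ∈ (Finset.univ.powersetCard k).filter (T.1 ⊆ ·),
      ∑ U ∈ K.powersetCard t, subsetSum j y U = ((k - j).choose (t - j) : ℝ) * subsetSum j y K := by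
    intro K hK
    simp only [Finset.mem_filter, Finset.mem_powersetCard] at hK
    rw [sum_subsetSum_subsets _ _ _ _ (by omega), hK.1.2, ← Nat.choose_symm (by omega)]
    congr 3
    omega
  rw [h1, Finset.sum_congr rfl h2, ← Finset.mul_sum,
    hy.sum_subsetSum_supersets _ (by simp [T.2]; omega) (by simpa using hv) (by rw [T.2]; omega), T.2]
  simp only [Fintype.card_fin]
  ring

lemma covM_eq_sum (v t k : ℕ) :
    covM v t k = ∑ i ∈ Finset.range (t + 1), (xi v t k i : ℝ) • johnsonA v t i := by
  ext T U
  have h := Finset.card_sdiff_add_card_inter T.1 U.1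
  rw [T.2] at h
  simp only [Matrix.sum_apply, Matrix.smul_apply, johnsonA, Matrix.of_apply, smul_eq_mul, covM]
  rw [Finset.sum_eq_single (T.1 \ U.1).card]
  · rw [if_pos (by omega), mul_one]
  · intro i _ hi
    rw [if_neg (by omega), mul_zero]
  · intro hn
    exact absurd (Finset.mem_range.2 (by omega)) hn

end Action

/-! ### Multiplicities, and separation of the eigenvalues of `A_1`. -/

section Multiplicities

variable {v t : ℕ}

lemma choose_lt_choose_succ {v j : ℕ} (h : 2 * (j + 1) ≤ v) : v.choose j < v.choose (j + 1) := by
  have h1 := Nat.choose_succ_right_eq v j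
  have h2 : 0 < v.choose j := Nat.choose_pos (by omega)
  have h3 : j + 2 ≤ v - j := by omega
  by_contra hcon
  nlinarith [Nat.mul_le_mul_left (v.choose j) h3]

lemma mult_pos {j : ℕ} (h : 2 * j ≤ v) : 0 < mult v j := by
  cases j with
  | zero => exact Nat.one_pos
  | succ j => exact Nat.sub_pos_of_lt (choose_lt_choose_succ h)

lemma sum_mult (h : 2 * t ≤ v) : ∑ j ∈ Finset.range (t + 1), mult v j = v.choose t := by
  induction t with
  | zero => simp [mult]
  | succ t ih =>
    rw [Finset.sum_range_succ, ih (by omega), mult]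
    have := choose_lt_choose_succ h
    omega

lemma johnsonP_one (h : 2 * t ≤ v) {j : ℕ} (hj : j ≤ t) :
    johnsonP v t 1 j = ((t : ℝ) - j) * ((v : ℝ) - t + 1 - j) - t := by
  rw [johnsonP, Finset.sum_range_succ, Finset.sum_range_one]
  simp only [Nat.choose_zero_right, Nat.sub_zero, Nat.sub_self, Nat.choose_one_right, pow_one,
    pow_zero, Nat.cast_one]
  rw [Nat.cast_sub hj, Nat.cast_sub (by omega : j ≤ v - t + 1), Nat.cast_add,
    Nat.cast_sub (by omega : t ≤ v)]
  push_cast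
  ring

lemma johnsonP_one_ne (h : 2 * t ≤ v) {i j : ℕ} (hi : i ≤ t) (hj : j ≤ t)
    (hij : i ≠ j) : johnsonP v t 1 i ≠ johnsonP v t 1 j := by
  rw [johnsonP_one h hi, johnsonP_one h hj]
  intro he
  -- The second factor cannot vanish, because `i + j ≤ 2t ≤ v`.
  have h1 : ((i : ℝ) - j) * ((v : ℝ) + 1 - i - j) = 0 := by linear_combination -he
  rcases mul_eq_zero.1 h1 with h2 | h2
  · exact hij (by exact_mod_cast sub_eq_zero.1 h2)
  · have : v + 1 = i + j := by
      have h3 : (v : ℝ) + 1 = i + j := by linarith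
      exact_mod_cast h3
    omega

end Multiplicities

/-! ### Dimension bounds, and the closed form of `θ_j`. -/

section HarmonicSpace

variable {v t j : ℕ}

/-- The extension by zero of a function on `j`-sets. -/
def extendZero (y : TSet v j → ℝ) (S : Finset (Fin v)) : ℝ :=
  if h : S.card = j then y ⟨S, h⟩ else 0

/-- The functions on `j`-sets that sum to zero over the `j`-sets containing any given
`(j-1)`-set. -/
noncomputable def shadowMap (v j : ℕ) :
    (TSet v j → ℝ) →ₗ[ℝ] ({Z : Finset (Fin v) // Z.card + 1 = j} → ℝ) where
  toFun y Z := ∑ S : TSet v j, if Z.1 ⊆ S.1 then y S else 0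
  map_add' x y := by
    ext Z
    simp only [Pi.add_apply, ← Finset.sum_add_distrib]
    exact Finset.sum_congr rfl fun S _ => by split_ifs <;> simp
  map_smul' c x := by
    ext Z
    simp only [Pi.smul_apply, smul_eq_mul, RingHom.id_apply, Finset.mul_sum]
    exact Finset.sum_congr rfl fun S _ => by split_ifs <;> simp

lemma card_tset (v j : ℕ) : Fintype.card (TSet v j) = v.choose j := by
  simp [TSet, Fintype.card_finset_len]

/-- Rank-nullity with `C(v, j)` unknowns and, for `j ≥ 1`, `C(v, j-1)` equations. -/
lemma mult_le_finrank_ker (v j : ℕ) :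
    mult v j ≤ Module.finrank ℝ (LinearMap.ker (shadowMap v j)) := by
  have h1 := LinearMap.finrank_range_add_finrank_ker (shadowMap v j)
  have h2 := Submodule.finrank_le (LinearMap.range (shadowMap v j))
  rw [Module.finrank_fintype_fun_eq_card] at h1 h2
  rw [card_tset] at h1
  cases j with
  | zero =>
    have : Fintype.card {Z : Finset (Fin v) // Z.card + 1 = 0} = 0 := by simp
    rw [Nat.choose_zero_right] at h1
    rw [mult]
    omega
  | succ j =>
    have : Fintype.card {Z : Finset (Fin v) // Z.card + 1 = j + 1} = v.choose j := by
      simp [Fintype.card_finset_len]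
    rw [mult]
    omega

lemma isHarmonic_extendZero {y : TSet v j → ℝ} (hy : y ∈ LinearMap.ker (shadowMap v j)) :
    IsHarmonic j (extendZero y) := by
  have key : ∀ d : ℕ, ∀ Z : Finset (Fin v), Z.card + d + 1 = j →
      ∑ S ∈ Finset.univ.powersetCard j with Z ⊆ S, extendZero y S = 0 := by
    intro d
    induction d with
    | zero =>
      intro Z hZ
      have h := congrFun (LinearMap.mem_ker.1 hy) ⟨Z, by omega⟩
      rw [Finset.sum_filter, ← sum_tset (fun S => if Z ⊆ S then extendZero y S else 0)]
      refine (Finset.sum_congr rfl fun S _ => ?_).trans h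
      simp [extendZero, S.2]
    | succ d ih =>
      intro Z hZ
      -- Downward induction on `|Z|`: each `S ⊇ Z` contains `insert x Z` for exactly `|S \ Z| = d +
      -- 2` points `x` outside `Z`.
      have h1 : ∑ x ∈ Zᶜ, ∑ S ∈ Finset.univ.powersetCard j with insert x Z ⊆ S, extendZero y S
          = ((d + 2 : ℕ) : ℝ) * ∑ S ∈ Finset.univ.powersetCard j with Z ⊆ S, extendZero y S := by
        rw [Finset.sum_comm' (t' := (Finset.univ.powersetCard j).filter (Z ⊆ ·))
          (s' := fun S => S \ Z), Finset.mul_sum]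
        · refine Finset.sum_congr rfl fun S hS => ?_
          simp only [Finset.mem_filter, Finset.mem_powersetCard] at hS
          rw [Finset.sum_const, nsmul_eq_mul, Finset.card_sdiff_of_subset hS.2]
          congr 2
          omega
        · intro x S
          simp only [Finset.mem_filter, Finset.mem_compl, Finset.mem_sdiff,
            Finset.insert_subset_iff]
          tauto
      rw [Finset.sum_eq_zero] at h1
      · rcases mul_eq_zero.1 h1.symm with h | h
        · exact absurd (Nat.cast_eq_zero.1 h) (by omega)
        · exact h
      · intro x hx
        apply ih
        rw [Finset.card_insert_of_notMem (by simpa using hx)]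
        omega
  intro Z hZ
  exact key (j - Z.card - 1) Z (by omega)

lemma subsetSum_extendZero_self (y : TSet v j → ℝ) (S : TSet v j) :
    subsetSum j (extendZero y) S.1 = y S := by
  obtain ⟨S, rfl⟩ := S
  simp [subsetSum, extendZero]

/-- Summing the lift over the `t`-sets containing a `j`-set `S` returns `C(v-2j, t-j) y(S)`, and
this binomial is nonzero since `t + j ≤ v`. -/
lemma eq_zero_of_liftT_eq_zero (hv : 2 * t ≤ v) (hj : j ≤ t) {y : TSet v j → ℝ}
    (hy : y ∈ LinearMap.ker (shadowMap v j)) (h : liftT v t j (extendZero y) = 0) : y = 0 := by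
  ext S
  have h1 := (isHarmonic_extendZero hy).sum_subsetSum_supersets (r := t) S.1
    (by rw [S.2]; simp; omega) (by simp; omega) (by rw [S.2]; exact hj)
  rw [subsetSum_extendZero_self, Finset.sum_eq_zero, S.2] at h1
  · rcases mul_eq_zero.1 h1.symm with h2 | h2
    · rw [Nat.cast_eq_zero, Nat.choose_eq_zero_iff] at h2
      simp at h2
      omega
    · exact h2
  · intro K hK
    simp only [Finset.mem_filter, Finset.mem_powersetCard] at hK
    exact congrFun h ⟨K, hK.1.2⟩

lemma mem_johnsonSpace {x : EuclideanSpace ℝ (TSet v t)} :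
    x ∈ johnsonSpace v t j ↔
      ∀ i ≤ t, (johnsonA v t i).mulVec (WithLp.ofLp x) = johnsonP v t i j • WithLp.ofLp x := by
  simp only [johnsonSpace, Submodule.mem_iInf, Module.End.mem_eigenspace_iff]
  constructor
  · intro h i hi
    have := congrArg WithLp.ofLp (h ⟨i, by omega⟩)
    simpa using this
  · intro h i
    apply (WithLp.ofLp_injective 2)
    simpa using h i (by omega)

lemma covM_mulVec_of_mem {k : ℕ} {x : EuclideanSpace ℝ (TSet v t)} (hx : x ∈ johnsonSpace v t j) :
    (covM v t k).mulVec (WithLp.ofLp x) = theta v t k j • WithLp.ofLp x := by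
  rw [covM_eq_sum, Matrix.sum_mulVec, theta, Finset.sum_smul]
  refine Finset.sum_congr rfl fun i hi => ?_
  rw [Finset.mem_range] at hi
  rw [Matrix.smul_mulVec, mem_johnsonSpace.1 hx i (by omega), smul_smul]

/-- The lift of harmonic functions into the common eigenspace. -/
noncomputable def liftMap (hv : 2 * t ≤ v) (hj : j ≤ t) :
    LinearMap.ker (shadowMap v j) →ₗ[ℝ] johnsonSpace v t j where
  toFun y := ⟨WithLp.toLp 2 (liftT v t j (extendZero y.1)), mem_johnsonSpace.2 fun i hi =>
    johnsonA_mulVec_liftT (isHarmonic_extendZero y.2) hv hj hi⟩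
  map_add' x y := by
    ext T
    simp only [liftT, subsetSum, Submodule.coe_add, PiLp.add_apply, ← Finset.sum_add_distrib]
    exact Finset.sum_congr rfl fun S _ => by unfold extendZero; split_ifs <;> simp
  map_smul' c x := by
    ext T
    simp only [liftT, subsetSum, Submodule.coe_smul, PiLp.smul_apply, smul_eq_mul,
      RingHom.id_apply, Finset.mul_sum]
    exact Finset.sum_congr rfl fun S _ => by unfold extendZero; split_ifs <;> simp

lemma liftMap_injective (hv : 2 * t ≤ v) (hj : j ≤ t) :
    Function.Injective (liftMap (v := v) hv hj) := by
  rw [← LinearMap.ker_eq_bot, LinearMap.ker_eq_bot']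
  intro y hy
  ext1
  refine eq_zero_of_liftT_eq_zero hv hj y.2 ?_
  exact congrArg (fun z => WithLp.ofLp (Subtype.val z)) hy

lemma mult_le_finrank_johnsonSpace (hv : 2 * t ≤ v) (hj : j ≤ t) :
    mult v j ≤ Module.finrank ℝ (johnsonSpace v t j) :=
  (mult_le_finrank_ker v j).trans
    (LinearMap.finrank_le_finrank_of_injective (liftMap_injective hv hj))

/-- A nonzero lifted harmonic function exists because `m_j > 0`; its two computed eigenvalues under
`M` must agree. -/
lemma theta_eq {k : ℕ} (hk : 2 * t ≤ k) (hv : k ≤ v) (hj : j ≤ t) :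
    theta v t k j = ((k - j).choose (t - j) : ℝ) * ((v - t - j).choose (k - t) : ℝ) := by
  have hpos : 0 < Module.finrank ℝ (LinearMap.ker (shadowMap v j)) :=
    (mult_pos (by omega)).trans_le (mult_le_finrank_ker v j)
  have := Module.finrank_pos_iff_exists_ne_zero.1 hpos
  obtain ⟨y, hy⟩ := this
  have hne : liftT v t j (extendZero y.1) ≠ 0 := fun h =>
    hy (Subtype.ext (eq_zero_of_liftT_eq_zero (by omega) hj y.2 h))
  have h1 := covM_mulVec_of_mem (k := k) (liftMap (by omega) hj y).2
  have h2 := covM_mulVec_liftT hk hv (isHarmonic_extendZero y.2) hj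
  exact smul_left_injective ℝ hne (h1.symm.trans h2)

end HarmonicSpace

/-! ### Orthogonal decomposition and the spectrum of `M`. -/

section Decomposition

variable {v t : ℕ}

lemma johnsonA_isHermitian (v t i : ℕ) : (johnsonA v t i).IsHermitian := by
  ext S T
  simp [johnsonA, Finset.inter_comm]

lemma orthogonalFamily_johnsonSpace (ht : 1 ≤ t) (hv : 2 * t ≤ v) :
    OrthogonalFamily ℝ (fun j : Fin (t + 1) => johnsonSpace v t j)
      fun j => (johnsonSpace v t j).subtypeₗᵢ := by
  refine OrthogonalFamily.of_pairwise fun i j hij x hx y hy => ?_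
  have h := (Matrix.isSymmetric_toEuclideanLin_iff.2
    (johnsonA_isHermitian v t 1)).orthogonalFamily_eigenspaces
  have hne : johnsonP v t 1 i ≠ johnsonP v t 1 j :=
    johnsonP_one_ne hv (by omega) (by omega) (fun he => hij (Fin.ext he))
  have hmem : ∀ l : Fin (t + 1), johnsonSpace v t l ≤
      Module.End.eigenspace (Matrix.toEuclideanLin (johnsonA v t 1)) (johnsonP v t 1 l) :=
    fun l => iInf_le (fun i : Fin (t + 1) =>
      Module.End.eigenspace (Matrix.toEuclideanLin (johnsonA v t i)) (johnsonP v t i l))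
      ⟨1, by omega⟩
  exact h.isOrtho hne (hmem i hx) y (hmem j hy)

/-- Independence bounds the total dimension above by `n = ∑ m_j`, while each dimension is at least
`m_j`; equality holds throughout. -/
lemma finrank_johnsonSpace_and_isInternal (ht : 1 ≤ t) (hv : 2 * t ≤ v) :
    (∀ j : Fin (t + 1), Module.finrank ℝ (johnsonSpace v t j) = mult v j) ∧
    DirectSum.IsInternal fun j : Fin (t + 1) => johnsonSpace v t j := by
  have hinj := (orthogonalFamily_johnsonSpace ht hv).independent.dfinsupp_lsum_injective
  have h1 : ∑ j : Fin (t + 1), mult v j = v.choose t := by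
    rw [← sum_mult hv, Finset.sum_range]
  have hle : ∀ j : Fin (t + 1), mult v j ≤ Module.finrank ℝ (johnsonSpace v t j) :=
    fun j => mult_le_finrank_johnsonSpace hv (by omega)
  have hn : Module.finrank ℝ (EuclideanSpace ℝ (TSet v t)) = v.choose t := by
    rw [finrank_euclideanSpace, card_tset]
  let F := DirectSum.coeLinearMap fun j : Fin (t + 1) => johnsonSpace v t j
  have hF : Function.Injective F := hinj
  have h2 := LinearMap.finrank_le_finrank_of_injective hF
  rw [Module.finrank_directSum, hn] at h2
  have h3 : ∑ j : Fin (t + 1), mult v j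
      = ∑ j : Fin (t + 1), Module.finrank ℝ (johnsonSpace v t j) :=
    le_antisymm (Finset.sum_le_sum fun j _ => hle j) (h1 ▸ h2)
  refine ⟨fun j => ((Finset.sum_eq_sum_iff_of_le fun j _ => hle j).1 h3 j
    (Finset.mem_univ j)).symm, hF, ?_⟩
  refine (LinearMap.injective_iff_surjective_of_finrank_eq_finrank ?_).1 hF
  rw [Module.finrank_directSum, hn, ← h3, h1]

lemma finrank_johnsonSpace (ht : 1 ≤ t) (hv : 2 * t ≤ v) (j : Fin (t + 1)) :
    Module.finrank ℝ (johnsonSpace v t j) = mult v j :=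
  (finrank_johnsonSpace_and_isInternal ht hv).1 j

lemma charpoly_covM (k : ℕ) (ht : 1 ≤ t) (hv : 2 * t ≤ v) :
    (covM v t k).charpoly = ∏ j : Fin (t + 1), (X - C (theta v t k j)) ^ mult v j := by
  have hint := (finrank_johnsonSpace_and_isInternal ht hv).2
  let b := hint.collectedBasis fun j => Module.finBasis ℝ (johnsonSpace v t j)
  have hb : ∀ a, Matrix.toEuclideanLin (covM v t k) (b a) = theta v t k a.1 • b a := by
    intro a
    apply WithLp.ofLp_injective 2
    have h : b a ∈ johnsonSpace v t a.1 := hint.collectedBasis_mem _ a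
    simpa only [Matrix.ofLp_toLpLin, Matrix.toLin'_apply, WithLp.ofLp_smul] using covM_mulVec_of_mem (k := k) h
  have h1 : LinearMap.toMatrix b b (Matrix.toEuclideanLin (covM v t k))
      = Matrix.diagonal fun a => theta v t k a.1 := by
    ext a c
    rw [LinearMap.toMatrix_apply, hb, map_smul, b.repr_self, Matrix.diagonal_apply]
    by_cases h : a = c
    · subst h; simp
    · simp [h]
  have h2 := LinearMap.charpoly_toMatrix (Matrix.toEuclideanLin (covM v t k)) b
  have h3 : Matrix.toEuclideanLin (covM v t k)
      = Matrix.toLin (PiLp.basisFun 2 ℝ _) (PiLp.basisFun 2 ℝ _) (covM v t k) :=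
    DFunLike.congr_fun (Matrix.toLpLin_eq_toLin 2 2) _
  rw [h1, Matrix.charpoly_diagonal, h3, Matrix.charpoly_toLin] at h2
  rw [← h2, Fintype.prod_sigma]
  refine Finset.prod_congr rfl fun j _ => ?_
  simp only [Finset.prod_const, Finset.card_univ, Fintype.card_fin]
  rw [finrank_johnsonSpace ht hv]

end Decomposition

/-! ### Columns of the idempotents `E_j`. -/

section Projections

variable {v t : ℕ}

/-- The column of `E_j` indexed by `T₀`, as a vector. -/
noncomputable def projCol (T₀ : TSet v t) (j : ℕ) : EuclideanSpace ℝ (TSet v t) :=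
  (johnsonSpace v t j).starProjection (EuclideanSpace.single T₀ 1)

lemma projCol_mem (T₀ : TSet v t) (j : ℕ) : projCol T₀ j ∈ johnsonSpace v t j :=
  Submodule.starProjection_apply_mem _ _

lemma sum_projCol (ht : 1 ≤ t) (hv : 2 * t ≤ v) (T₀ : TSet v t) :
    ∑ j : Fin (t + 1), projCol T₀ j = EuclideanSpace.single T₀ 1 := by
  refine (orthogonalFamily_johnsonSpace ht hv).sum_projection_of_mem_iSup _ ?_
  rw [(finrank_johnsonSpace_and_isInternal ht hv).2.submodule_iSup_eq_top]
  trivial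

lemma inner_projCol_of_ne (ht : 1 ≤ t) (hv : 2 * t ≤ v) (T₀ : TSet v t) {i j : Fin (t + 1)}
    (hij : i ≠ j) : inner ℝ (projCol T₀ i) (projCol T₀ j) = 0 :=
  (orthogonalFamily_johnsonSpace ht hv).isOrtho hij.symm (projCol_mem T₀ j) _ (projCol_mem T₀ i)

lemma inner_projCol_self (T₀ : TSet v t) (j : ℕ) :
    inner ℝ (projCol T₀ j) (projCol T₀ j) = projCol T₀ j T₀ := by
  rw [projCol, Submodule.inner_starProjection_left_eq_right,
    Submodule.starProjection_eq_self_iff.2 (Submodule.starProjection_apply_mem _ _)]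
  simp [EuclideanSpace.inner_single_left]

/-- The action of a permutation of the points on the `t`-sets. -/
def permTSet (t : ℕ) (σ : Equiv.Perm (Fin v)) : Equiv.Perm (TSet v t) :=
  σ.finsetCongr.subtypeEquiv fun S => by simp

lemma exists_permTSet_eq (S T : TSet v t) : ∃ σ : Equiv.Perm (Fin v), permTSet t σ S = T := by
  have hc : Fintype.card S.1 = Fintype.card T.1 := by simp [S.2, T.2]
  let e : {x // x ∈ S.1} ≃ {x // x ∈ T.1} := Fintype.equivOfCardEq hc
  refine ⟨e.extendSubtype, Subtype.ext ?_⟩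
  apply Finset.eq_of_subset_of_card_le
  · intro x hx
    simp only [permTSet, Equiv.subtypeEquiv_apply, Equiv.finsetCongr_apply, Finset.mem_map] at hx
    obtain ⟨y, hy, rfl⟩ := hx
    exact e.extendSubtype_mem y hy
  · rw [T.2, (permTSet t _ S).2]

lemma johnsonA_permTSet (σ : Equiv.Perm (Fin v)) (i : ℕ) (S T : TSet v t) :
    johnsonA v t i (permTSet t σ S) (permTSet t σ T) = johnsonA v t i S T := by
  simp only [johnsonA, Matrix.of_apply, permTSet, Equiv.subtypeEquiv_apply,
    Equiv.finsetCongr_apply, ← Finset.map_inter, Finset.card_map]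

/-- The isometry of `ℝ^n` induced by a permutation of the points. -/
noncomputable def permIso (t : ℕ) (σ : Equiv.Perm (Fin v)) :
    EuclideanSpace ℝ (TSet v t) ≃ₗᵢ[ℝ] EuclideanSpace ℝ (TSet v t) :=
  LinearIsometryEquiv.piLpCongrLeft 2 ℝ ℝ (permTSet t σ)

lemma permIso_apply (σ : Equiv.Perm (Fin v)) (x : EuclideanSpace ℝ (TSet v t)) (S : TSet v t) :
    permIso t σ x (permTSet t σ S) = x S := by
  simp [permIso, LinearIsometryEquiv.piLpCongrLeft_apply, Equiv.piCongrLeft']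

lemma map_permIso_johnsonSpace (σ : Equiv.Perm (Fin v)) (j : ℕ) :
    (johnsonSpace v t j).map ((permIso t σ).toLinearEquiv : _ →ₗ[ℝ] _) = johnsonSpace v t j := by
  apply Submodule.eq_of_le_of_finrank_eq
  · rintro _ ⟨x, hx, rfl⟩
    rw [mem_johnsonSpace]
    intro i hi
    ext T
    obtain ⟨S, rfl⟩ := (permTSet t σ).surjective T
    have h := congrFun (mem_johnsonSpace.1 hx i hi) S
    simp only [Matrix.mulVec, dotProduct, Pi.smul_apply, smul_eq_mul] at h ⊢
    rw [← Equiv.sum_comp (permTSet t σ)]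
    refine Eq.trans (Finset.sum_congr rfl fun U _ => ?_) (h.trans ?_)
    · rw [johnsonA_permTSet]
      exact congrArg _ (permIso_apply σ x U)
    · exact congrArg _ (permIso_apply σ x S).symm
  · exact LinearEquiv.finrank_map_eq _ _

/-- Point permutations act transitively on `t`-sets and preserve each eigenspace, so they commute
with its projection. -/
lemma projCol_apply_self_eq (S T : TSet v t) (j : ℕ) : projCol T j T = projCol S j S := by
  obtain ⟨σ, rfl⟩ := exists_permTSet_eq S T
  have h := Submodule.starProjection_map_apply (permIso t σ) (johnsonSpace v t j)
    (EuclideanSpace.single (permTSet t σ S) 1)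
  have hs : (permIso t σ).symm (EuclideanSpace.single (permTSet t σ S) 1)
      = EuclideanSpace.single S (1 : ℝ) := by
    rw [LinearIsometryEquiv.symm_apply_eq]
    exact (EuclideanSpace.piLpCongrLeft_single _ _ _).symm
  simp only [map_permIso_johnsonSpace] at h
  rw [hs] at h
  rw [projCol, h, permIso_apply]
  rfl

/-- The `n` equal diagonal entries of a projection sum to its trace, the dimension `m_j`. -/
lemma projCol_apply_self (ht : 1 ≤ t) (hv : 2 * t ≤ v) (T₀ : TSet v t) (j : Fin (t + 1)) :
    projCol T₀ j T₀ = (mult v j : ℝ) / v.choose t := by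
  have hp : LinearMap.IsProj (johnsonSpace v t j)
      ((johnsonSpace v t j).starProjection : _ →ₗ[ℝ] EuclideanSpace ℝ (TSet v t)) :=
    ⟨fun x => Submodule.starProjection_apply_mem _ _,
      fun x hx => Submodule.starProjection_eq_self_iff.2 hx⟩
  have h1 := hp.trace
  rw [LinearMap.trace_eq_sum_inner _ (EuclideanSpace.basisFun (TSet v t) ℝ),
    finrank_johnsonSpace ht hv] at h1
  have h2 : ∀ T : TSet v t, inner ℝ (EuclideanSpace.basisFun (TSet v t) ℝ T)
      (((johnsonSpace v t j).starProjection : _ →ₗ[ℝ] EuclideanSpace ℝ (TSet v t))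
        (EuclideanSpace.basisFun (TSet v t) ℝ T)) = projCol T₀ j T₀ := by
    intro T
    rw [projCol_apply_self_eq T T₀]
    simp [EuclideanSpace.inner_single_left, projCol]
  rw [Finset.sum_congr rfl fun T _ => h2 T, Finset.sum_const, Finset.card_univ, card_tset,
    nsmul_eq_mul] at h1
  rw [eq_div_iff (Nat.cast_ne_zero.2 (Nat.choose_pos (by omega)).ne'), ← h1, mul_comm]

/-- The all-ones vector. -/
noncomputable def onesVec (v t : ℕ) : EuclideanSpace ℝ (TSet v t) := WithLp.toLp 2 1

lemma onesVec_mem (hv : 2 * t ≤ v) : onesVec v t ∈ johnsonSpace v t 0 := by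
  rw [mem_johnsonSpace]
  intro i hi
  have hy : IsHarmonic 0 (fun _ : Finset (Fin v) => (1 : ℝ)) := fun Z hZ => absurd hZ (by simp)
  have h := johnsonA_mulVec_liftT hy hv (Nat.zero_le t) hi
  have h1 : liftT v t 0 (fun _ => (1 : ℝ)) = 1 := by
    ext T; simp [liftT, subsetSum]
  rwa [h1] at h

lemma inner_projCol_onesVec (ht : 1 ≤ t) (hv : 2 * t ≤ v) (T₀ : TSet v t) (j : Fin (t + 1)) :
    inner ℝ (projCol T₀ j) (onesVec v t) = if j = 0 then 1 else 0 := by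
  rw [projCol, Submodule.inner_starProjection_left_eq_right]
  split_ifs with h
  · subst h
    rw [Fin.val_zero, Submodule.starProjection_eq_self_iff.2 (onesVec_mem hv)]
    simp [EuclideanSpace.inner_single_left, onesVec]
  · rw [Submodule.starProjection_apply, Submodule.orthogonalProjectionOnto_apply_of_mem_orthogonal]
    · simp
    · exact (orthogonalFamily_johnsonSpace ht hv).isOrtho (Ne.symm h) (onesVec_mem hv)

end Projections

/-! ### Rank-one perturbations: characteristic polynomials of `M₁` and `R`. -/

section Reduction

variable {v t k : ℕ}

/-- Matrix determinant lemma. Supplying a solution `b` of `(x - N) b = a` avoids inverting `x - N`.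
-/
lemma eval_charpoly_add_vecMulVec {n : Type*} [Fintype n] [DecidableEq n] (N : Matrix n n ℝ)
    (a b w : n → ℝ) (x : ℝ) (h : (Matrix.scalar n x - N).mulVec b = a) :
    (N + Matrix.vecMulVec a w).charpoly.eval x = N.charpoly.eval x * (1 - w ⬝ᵥ b) := by
  rw [Matrix.eval_charpoly, Matrix.eval_charpoly]
  have h1 : Matrix.scalar n x - (N + Matrix.vecMulVec a w)
      = (Matrix.scalar n x - N) * (1 - Matrix.replicateCol Unit b * Matrix.replicateRow Unit w) := by
    rw [← Matrix.vecMulVec_eq, Matrix.mul_sub, Matrix.mul_one, Matrix.mul_vecMulVec, h]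
    abel
  rw [h1, Matrix.det_mul, Matrix.det_one_sub_mul_comm]
  congr 1
  simp [Matrix.det_unique, Matrix.mul_apply, dotProduct]

lemma covM₁_eq (T₀ : TSet v t) :
    covM₁ k T₀ = covM v t k
      + Matrix.vecMulVec ((covM v t k).mulVec (1 - Pi.single T₀ 1)) (Pi.single T₀ 1) := by
  have hB : matB T₀ = 1 + Matrix.vecMulVec (1 - Pi.single T₀ (1 : ℝ)) (Pi.single T₀ 1) := by
    ext S T
    simp only [matB, Matrix.of_apply, Matrix.add_apply, Matrix.one_apply, Matrix.vecMulVec_apply,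
      Pi.sub_apply, Pi.one_apply, Pi.single_apply]
    by_cases hT : T = T₀
    · subst hT; by_cases hS : S = T <;> simp [hS]
    · simp [hT]
  rw [covM₁, hB, Matrix.mul_add, Matrix.mul_one, Matrix.mul_vecMulVec]

lemma sum_projCol_ofLp (ht : 1 ≤ t) (hv : 2 * t ≤ v) (T₀ : TSet v t) :
    (Pi.single T₀ 1 : TSet v t → ℝ) = ∑ j : Fin (t + 1), WithLp.ofLp (projCol T₀ j) := by
  rw [← WithLp.ofLp_sum, sum_projCol ht hv]
  simp

lemma covM_mulVec_ones_sub_single (ht : 1 ≤ t) (hv : 2 * t ≤ v) (T₀ : TSet v t) :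
    (covM v t k).mulVec (1 - Pi.single T₀ 1)
      = theta v t k 0 • 1 - ∑ j : Fin (t + 1), theta v t k j • WithLp.ofLp (projCol T₀ j) := by
  rw [Matrix.mulVec_sub, sum_projCol_ofLp ht hv, Matrix.mulVec_sum]
  congr 1
  · exact covM_mulVec_of_mem (onesVec_mem hv)
  · exact Finset.sum_congr rfl fun j _ => covM_mulVec_of_mem (projCol_mem T₀ j)

/-- The perturbation weights: `χ_R(x) = ∏ (x - θ_j) (1 - ∑ c_j θ_j / (x - θ_j))`. -/
noncomputable def weight (v t : ℕ) (j : Fin (t + 1)) : ℝ :=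
  (if j = 0 then 1 else 0) - (mult v j : ℝ) / v.choose t

lemma eval_charpoly_covM₁ (ht : 1 ≤ t) (hv : 2 * t ≤ v) (T₀ : TSet v t) (x : ℝ)
    (hx : ∀ j : Fin (t + 1), x ≠ theta v t k j) :
    (covM₁ k T₀).charpoly.eval x = (∏ j : Fin (t + 1), (x - theta v t k j) ^ mult v j)
      * (1 - ∑ j : Fin (t + 1), weight v t j * theta v t k j / (x - theta v t k j)) := by
  set c : ℕ → ℝ := fun j => theta v t k j / (x - theta v t k j) with hc
  have hM : ∀ (j : Fin (t + 1)) (y : EuclideanSpace ℝ (TSet v t)), y ∈ johnsonSpace v t j →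
      (Matrix.scalar (TSet v t) x - covM v t k).mulVec (c j • WithLp.ofLp y)
        = theta v t k j • WithLp.ofLp y := by
    intro j y hy
    rw [Matrix.mulVec_smul, Matrix.sub_mulVec, covM_mulVec_of_mem hy, Matrix.scalar_apply,
      ← Matrix.smul_one_eq_diagonal, Matrix.smul_mulVec, Matrix.one_mulVec, ← sub_smul, smul_smul,
      hc]
    congr 1
    exact div_mul_cancel₀ _ (sub_ne_zero.2 (hx j))
  rw [covM₁_eq, eval_charpoly_add_vecMulVec _ _
    -- The system is solved eigenspace by eigenspace, scaling each component by `1 / (x - θ_j)`; the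
    -- `T₀` entry of the solution produces the weights.
    (c 0 • 1 - ∑ j : Fin (t + 1), c j • WithLp.ofLp (projCol T₀ j)), charpoly_covM k ht hv]
  · congr 1
    · simp [eval_prod]
    · simp only [single_dotProduct, one_mul, Pi.sub_apply, Pi.smul_apply, Pi.one_apply,
        Finset.sum_apply, smul_eq_mul, mul_one, projCol_apply_self ht hv, weight]
      congr 1
      simp only [sub_mul, sub_div, Finset.sum_sub_distrib]
      congr 1
      · simp [ite_div, hc]
      · exact Finset.sum_congr rfl fun j _ => by simp only [hc]; ring
  · rw [covM_mulVec_ones_sub_single ht hv, Matrix.mulVec_sub, Matrix.mulVec_sum]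
    congr 1
    · exact hM 0 _ (onesVec_mem hv)
    · exact Finset.sum_congr rfl fun j _ => hM j _ (projCol_mem T₀ j)

lemma norm_projCol (ht : 1 ≤ t) (hv : 2 * t ≤ v) (T₀ : TSet v t) (j : Fin (t + 1)) :
    ‖projCol T₀ j‖ = √((mult v j : ℝ) / v.choose t) := by
  rw [← projCol_apply_self ht hv T₀ j, ← inner_projCol_self, real_inner_self_eq_norm_sq,
    Real.sqrt_sq (norm_nonneg _)]

lemma unitE_eq (T₀ : TSet v t) (j : ℕ) : unitE T₀ j = ‖projCol T₀ j‖⁻¹ • projCol T₀ j := rfl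

lemma unitE_mem (T₀ : TSet v t) (j : ℕ) : unitE T₀ j ∈ johnsonSpace v t j := by
  rw [unitE_eq]
  exact Submodule.smul_mem _ _ (projCol_mem T₀ j)

lemma norm_projCol_pos (ht : 1 ≤ t) (hv : 2 * t ≤ v) (T₀ : TSet v t) (j : Fin (t + 1)) :
    0 < ‖projCol T₀ j‖ := by
  rw [norm_projCol ht hv]
  have h1 : 0 < mult v j := mult_pos (by omega)
  have h2 : 0 < v.choose t := Nat.choose_pos (by omega)
  positivity

lemma inner_unitE (ht : 1 ≤ t) (hv : 2 * t ≤ v) (T₀ : TSet v t) (i j : Fin (t + 1)) :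
    inner ℝ (unitE T₀ i) (unitE T₀ j) = if i = j then 1 else 0 := by
  rw [unitE_eq, unitE_eq, real_inner_smul_left, real_inner_smul_right]
  split_ifs with h
  · subst h
    rw [real_inner_self_eq_norm_sq]
    have := (norm_projCol_pos ht hv T₀ i).ne'
    field_simp
  · rw [inner_projCol_of_ne ht hv T₀ h]; simp

lemma unitE_apply_self (ht : 1 ≤ t) (hv : 2 * t ≤ v) (T₀ : TSet v t) (j : Fin (t + 1)) :
    unitE T₀ j T₀ = ‖projCol T₀ j‖ := by
  have h : projCol T₀ j T₀ = ‖projCol T₀ j‖ ^ 2 := by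
    rw [← inner_projCol_self, real_inner_self_eq_norm_sq]
  rw [unitE_eq, PiLp.smul_apply, h, smul_eq_mul]
  have := (norm_projCol_pos ht hv T₀ j).ne'
  field_simp

lemma inner_unitE_onesVec (ht : 1 ≤ t) (hv : 2 * t ≤ v) (T₀ : TSet v t) (j : Fin (t + 1)) :
    inner ℝ (unitE T₀ j) (onesVec v t) = if j = 0 then ‖projCol T₀ j‖⁻¹ else 0 := by
  rw [unitE_eq, real_inner_smul_left, inner_projCol_onesVec ht hv]
  simp

lemma dotProduct_covM_mulVec (T₀ : TSet v t) (i : ℕ) {k : ℕ} (y : TSet v t → ℝ) :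
    WithLp.ofLp (unitE T₀ i) ⬝ᵥ (covM v t k).mulVec y
      = theta v t k i * (WithLp.ofLp (unitE T₀ i) ⬝ᵥ y) := by
  have hs : (covM v t k).transpose = covM v t k := by
    rw [covM_eq_sum, Matrix.transpose_sum]
    refine Finset.sum_congr rfl fun i _ => ?_
    rw [Matrix.transpose_smul]
    congr 1
    ext S T
    simp [johnsonA, Finset.inter_comm]
  rw [Matrix.dotProduct_mulVec, ← Matrix.mulVec_transpose, hs, covM_mulVec_of_mem (unitE_mem T₀ i),
    smul_dotProduct, smul_eq_mul]

lemma ofLp_dotProduct (x y : EuclideanSpace ℝ (TSet v t)) :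
    WithLp.ofLp x ⬝ᵥ WithLp.ofLp y = inner ℝ x y := by
  rw [EuclideanSpace.inner_eq_star_dotProduct, star_trivial, dotProduct_comm]

lemma matR_apply (T₀ : TSet v t) (i j : Fin (t + 1)) :
    matR k T₀ i j
      = WithLp.ofLp (unitE T₀ i) ⬝ᵥ (covM₁ k T₀).mulVec (WithLp.ofLp (unitE T₀ j)) := by
  have : matR k T₀ = (matV T₀).transpose * (covM₁ k T₀ * matV T₀) := by
    rw [matR, covM₁]; simp only [Matrix.mul_assoc]
  rw [this]
  rfl

/-- The `T₀` entry of `e^(j)` is `√(m_j/n)`, and `e^(i)` is orthogonal to the all-ones vector except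
that `e^(0)` pairs with it to `√n`. -/
lemma matR_eq (ht : 1 ≤ t) (hv : 2 * t ≤ v) (T₀ : TSet v t) :
    matR k T₀
      = matTheta v t k * (1 + Matrix.vecMulVec
          (fun i : Fin (t + 1) =>
            (if i = 0 then 1 else 0) - √(mult v i : ℝ) / (v.choose t : ℝ))
          (fun j : Fin (t + 1) => √(mult v j : ℝ))) := by
  have hn : (0 : ℝ) < v.choose t := by exact_mod_cast Nat.choose_pos (by omega)
  ext i j
  rw [matR_apply, covM₁_eq, Matrix.add_mulVec, dotProduct_add, dotProduct_covM_mulVec,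
    Matrix.vecMulVec_mulVec, ofLp_dotProduct, inner_unitE ht hv, single_dotProduct,
    unitE_apply_self ht hv, matTheta, Matrix.diagonal_mul, Matrix.add_apply, Matrix.one_apply,
    Matrix.vecMulVec_apply]
  simp only [op_smul_eq_smul, one_mul, dotProduct_smul, smul_eq_mul]
  rw [dotProduct_covM_mulVec, dotProduct_sub, dotProduct_single, unitE_apply_self ht hv]
  have h1 : WithLp.ofLp (unitE T₀ i) ⬝ᵥ (1 : TSet v t → ℝ)
      = if i = 0 then ‖projCol T₀ i‖⁻¹ else 0 := by
    rw [← inner_unitE_onesVec ht hv, ← ofLp_dotProduct]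
    rfl
  rw [h1, norm_projCol ht hv, norm_projCol ht hv, Real.sqrt_div (Nat.cast_nonneg _),
    Real.sqrt_div (Nat.cast_nonneg _)]
  have hs := Real.mul_self_sqrt hn.le
  have hs0 := Real.sqrt_pos.2 hn
  set r := √(v.choose t : ℝ)
  rw [← hs]
  by_cases h2 : i = 0
  · subst h2
    have hm : (mult v ((0 : Fin (t + 1)) : ℕ) : ℝ) = 1 := by simp [mult]
    simp only [hm, Real.sqrt_one, if_true]
    field_simp
  · simp only [if_neg h2, zero_sub]
    field_simp

lemma eval_charpoly_matR (ht : 1 ≤ t) (hv : 2 * t ≤ v) (T₀ : TSet v t) (x : ℝ)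
    (hx : ∀ j : Fin (t + 1), x ≠ theta v t k j) :
    (matR k T₀).charpoly.eval x = (∏ j : Fin (t + 1), (x - theta v t k j))
      * (1 - ∑ j : Fin (t + 1), weight v t j * theta v t k j / (x - theta v t k j)) := by
  rw [matR_eq ht hv, Matrix.mul_add, Matrix.mul_one, Matrix.mul_vecMulVec]
  set u := fun i : Fin (t + 1) =>
            (if i = 0 then (1 : ℝ) else 0) - √(mult v i : ℝ) / (v.choose t : ℝ) with hu
  rw [eval_charpoly_add_vecMulVec _ _ (fun j : Fin (t + 1) => theta v t k j * u j / (x - theta v t k j)),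
    matTheta, Matrix.charpoly_diagonal]
  · congr 1
    · simp [eval_prod]
    · congr 1
      refine Finset.sum_congr rfl fun j _ => ?_
      have hw : weight v t j = √(mult v j : ℝ) * u j := by
        have hs := Real.mul_self_sqrt (Nat.cast_nonneg (α := ℝ) (mult v j))
        simp only [hu, weight, mul_sub]
        congr 1
        · split_ifs with h
          · subst h; simp [mult]
          · simp
        · rw [← mul_div_assoc, hs]
      rw [hw]
      ring
  · ext i
    simp only [matTheta, Matrix.scalar_apply, Matrix.diagonal_sub, Matrix.mulVec_diagonal]
    exact mul_div_cancel₀ _ (sub_ne_zero.2 (hx i))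

lemma charpoly_covM₁ (ht : 1 ≤ t) (hv : 2 * t ≤ v) (T₀ : TSet v t) :
    (covM₁ k T₀).charpoly
      = (matR k T₀).charpoly * ∏ j ∈ Finset.Icc 1 t, (X - C (theta v t k j)) ^ (mult v j - 1) := by
  refine Polynomial.eq_of_infinite_eval_eq _ _ ((Set.Finite.infinite_compl
    (Set.finite_range fun j : Fin (t + 1) => theta v t k j)).mono fun x hx => ?_)
  have hx' : ∀ j : Fin (t + 1), x ≠ theta v t k j := fun j h => hx ⟨j, h.symm⟩
  show _ = _
  rw [eval_mul, eval_charpoly_covM₁ ht hv T₀ x hx', eval_charpoly_matR ht hv T₀ x hx', mul_right_comm]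
  congr 1
  have h1 : ∏ j ∈ Finset.Icc 1 t, (x - theta v t k j) ^ (mult v j - 1)
      = ∏ j : Fin (t + 1), (x - theta v t k j) ^ (mult v j - 1) := by
    rw [← Finset.prod_range (fun j => (x - theta v t k j) ^ (mult v j - 1))]
    apply Finset.prod_subset
    · intro j; simp only [Finset.mem_Icc, Finset.mem_range]; omega
    · intro j h2 h3
      simp only [Finset.mem_Icc, Finset.mem_range] at h2 h3
      -- The extra factor `j = 0` is trivial because `m_0 = 1`.
      obtain rfl : j = 0 := by omega
      simp [mult]
  simp only [eval_prod, eval_pow, eval_sub, eval_X, eval_C]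
  rw [h1, ← Finset.prod_mul_distrib]
  refine Finset.prod_congr rfl fun j _ => ?_
  rw [← pow_succ', Nat.sub_add_cancel (mult_pos (by omega))]

lemma rank_matR_sub_matTheta (ht : 1 ≤ t) (hk : 2 * t ≤ k) (hv : k ≤ v) (T₀ : TSet v t) :
    (matR k T₀ - matTheta v t k).rank = 1 := by
  rw [matR_eq ht (hk.trans hv), Matrix.mul_add, Matrix.mul_one, Matrix.mul_vecMulVec,
    add_sub_cancel_left]
  refine le_antisymm (Matrix.rank_vecMulVec_le _ _) (Nat.one_le_iff_ne_zero.2 fun h => ?_)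
  rw [Matrix.rank, Submodule.finrank_eq_zero, LinearMap.range_eq_bot] at h
  -- The `(0, 0)` entry is `θ_0 (1 - 1/n)`, nonzero since `0 < t < v` forces `n ≠ 1`.
  have h0 := congrFun (LinearMap.congr_fun h (Pi.single 0 1)) 0
  rw [Matrix.mulVecLin_apply, Matrix.mulVec_single_one, Matrix.col_apply] at h0
  simp only [Matrix.vecMulVec_apply, matTheta, Matrix.mulVec_diagonal, Fin.val_zero, mult,
    LinearMap.zero_apply, Pi.zero_apply, if_true, Nat.cast_one, Real.sqrt_one, mul_one] at h0
  have h1 : 0 < theta v t k 0 := by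
    rw [theta_eq hk hv (Nat.zero_le t)]
    have h2 : 0 < (k - 0).choose (t - 0) := Nat.choose_pos (by omega)
    have h3 : 0 < (v - t - 0).choose (k - t) := Nat.choose_pos (by omega)
    positivity
  rcases mul_eq_zero.1 h0 with h2 | h2
  · exact h1.ne' h2
  · have h3 : (v.choose t : ℝ) = 1 := by
      have hn : (0 : ℝ) < v.choose t := by exact_mod_cast Nat.choose_pos (by omega)
      field_simp at h2
      linarith
    have h4 : v.choose t = 1 := by exact_mod_cast h3
    rw [Nat.choose_eq_one_iff] at h4
    omega

end Reduction

/-! ### Roots of the secular equation by sign changes. -/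

section SecularEquation

/-- A monic real polynomial whose values alternate in sign at `d + 1` points, where `d` is its
degree, is a product of distinct linear factors, with roots between the extreme points. -/
lemma exists_roots_of_alternating {p : ℝ[X]} {d : ℕ} (hp : p.Monic) (hd : p.natDegree = d)
    (b : ℕ → ℝ) (hb : ∀ j < d, b (j + 1) < b j) (hs : ∀ j ≤ d, 0 < (-1 : ℝ) ^ j * p.eval (b j)) :
    ∃ ρ : Fin d → ℝ, StrictMono ρ ∧ p = ∏ i, (X - C (ρ i)) ∧ ∀ i, b d < ρ i ∧ ρ i < b 0 := by
  have hanti : ∀ i j, i ≤ j → j ≤ d → b j ≤ b i := by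
    intro i j hij hj
    induction j, hij using Nat.le_induction with
    | base => exact le_rfl
    | succ j hij ih => exact (hb j hj).le.trans (ih (by omega))
  have hroot : ∀ j < d, ∃ r, (b (j + 1) < r ∧ r < b j) ∧ p.eval r = 0 := by
    intro j hj
    have hc : ContinuousOn (fun x => (-1 : ℝ) ^ j * p.eval x) (Set.Icc (b (j + 1)) (b j)) :=
      (continuous_const.mul p.continuous).continuousOn
    have h1 := hs j (by omega)
    have h2 := hs (j + 1) hj
    rw [pow_succ] at h2
    have h3 := intermediate_value_Ioo (hb j hj).le hc
      (show (0 : ℝ) ∈ Set.Ioo _ _ from ⟨by linarith, h1⟩)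
    obtain ⟨r, hr, hr0⟩ := h3
    exact ⟨r, hr, (mul_eq_zero.1 hr0).resolve_left (by simp)⟩
  choose! r hr hr0 using hroot
  have hranti : ∀ i j, i < j → j < d → r j < r i := fun i j hij hj =>
    (hr j hj).2.trans_le ((hanti (i + 1) j hij hj.le).trans (hr i (hij.trans hj)).1.le)
  -- The roots `r j` decrease with `j`; reversing the index makes them increase.
  let ρ : Fin d → ℝ := fun i => r (Fin.rev i)
  have hρ : StrictMono ρ := fun i j hij => hranti _ _ (Fin.rev_lt_rev.2 hij) (Fin.rev i).2
  refine ⟨ρ, hρ, ?_, fun i => ⟨?_, ?_⟩⟩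
  · refine (Polynomial.eq_of_monic_of_dvd_of_natDegree_le
      (monic_prod_of_monic _ _ fun i _ => monic_X_sub_C _) hp ?_ ?_)
    · refine Finset.prod_dvd_of_coprime
        ((pairwise_coprime_X_sub_C hρ.injective).set_pairwise _) fun i _ => ?_
      exact dvd_iff_isRoot.2 (hr0 _ (Fin.rev i).2)
    · rw [natDegree_prod_of_monic _ _ fun i _ => monic_X_sub_C _]
      simp [hd]
  · exact (hanti _ d (Fin.rev i).2 le_rfl).trans_lt (hr _ (Fin.rev i).2).1
  · exact (hr _ (Fin.rev i).2).2.trans_le (hanti 0 _ (Nat.zero_le _) (Fin.rev i).2.le)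

/-- The secular formula is unavailable at a pole; clearing denominators gives a polynomial identity
valid there, in which one term survives. -/
lemma eval_secular_pole {t : ℕ} {θ a : ℕ → ℝ} {p : ℝ[X]}
    (hp : ∀ x, (∀ j ∈ Finset.range (t + 1), x ≠ θ j) →
      p.eval x = (∏ j ∈ Finset.range (t + 1), (x - θ j))
        * (1 - ∑ j ∈ Finset.range (t + 1), a j / (x - θ j)))
    {j : ℕ} (hj : j ∈ Finset.range (t + 1)) :
    p.eval (θ j) = -(a j * ∏ i ∈ (Finset.range (t + 1)).erase j, (θ j - θ i)) := by
  have hpq : p = (∏ j ∈ Finset.range (t + 1), (X - C (θ j)))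
      - ∑ j ∈ Finset.range (t + 1), C (a j) * ∏ i ∈ (Finset.range (t + 1)).erase j,
        (X - C (θ i)) := by
    refine Polynomial.eq_of_infinite_eval_eq _ _ ((Set.Finite.infinite_compl
      ((Finset.range (t + 1)).image θ).finite_toSet).mono fun x hx => ?_)
    have hx' : ∀ j ∈ Finset.range (t + 1), x ≠ θ j := fun j hj h =>
      hx (Finset.mem_coe.2 (Finset.mem_image.2 ⟨j, hj, h.symm⟩))
    show _ = _
    rw [hp x hx']
    simp only [eval_sub, eval_finsetSum, eval_mul, eval_C, eval_prod, eval_X]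
    rw [mul_sub, mul_one, Finset.mul_sum]
    congr 1
    refine Finset.sum_congr rfl fun l hl => ?_
    rw [← Finset.mul_prod_erase _ _ hl]
    have := sub_ne_zero.2 (hx' l hl)
    field_simp
  rw [hpq]
  simp only [eval_sub, eval_finsetSum, eval_mul, eval_C, eval_prod, eval_X]
  rw [Finset.prod_eq_zero hj (sub_self _), Finset.sum_eq_single j, zero_sub]
  · intro l _ hlj
    rw [Finset.prod_eq_zero (Finset.mem_erase.2 ⟨hlj.symm, hj⟩) (sub_self _), mul_zero]
  · exact fun h => absurd hj h

lemma neg_one_pow_mul_prod_sub_pos {m : ℕ} {θ : ℕ → ℝ} {x : ℝ} (h : ∀ i < m, x < θ i) :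
    0 < (-1 : ℝ) ^ m * ∏ i ∈ Finset.range m, (x - θ i) := by
  have : (-1 : ℝ) ^ m * ∏ i ∈ Finset.range m, (x - θ i) = ∏ i ∈ Finset.range m, (θ i - x) := by
    rw [show (-1 : ℝ) ^ m = ∏ _i ∈ Finset.range m, (-1 : ℝ) by simp, ← Finset.prod_mul_distrib]
    exact Finset.prod_congr rfl fun i _ => by ring
  rw [this]
  exact Finset.prod_pos fun i hi => sub_pos.2 (h i (Finset.mem_range.1 hi))

/-- The roots of the secular equation of the rank-one perturbation `Θ (I + u wᵀ)`. -/
lemma exists_roots_of_secular {t : ℕ} (ht : 1 ≤ t) {θ μ : ℕ → ℝ}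
    (hθ : ∀ i j, i < j → j ≤ t → θ j < θ i) (hpos : 0 < θ t) (hμ : ∀ j, j ≤ t → 0 < μ j)
    (hsum : ∑ j ∈ Finset.range (t + 1), μ j = 1) {p : ℝ[X]} (hm : p.Monic)
    (hd : p.natDegree = t + 1)
    (hp : ∀ x, (∀ j ∈ Finset.range (t + 1), x ≠ θ j) →
      p.eval x = (∏ j ∈ Finset.range (t + 1), (x - θ j))
        * (1 - ∑ j ∈ Finset.range (t + 1), ((if j = 0 then 1 else 0) - μ j) * θ j / (x - θ j))) :
    ∃ ρ : Fin (t + 1) → ℝ, StrictMono ρ ∧ p = ∏ i, (X - C (ρ i)) ∧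
      ∀ i, θ t / 2 < ρ i ∧ ρ i < 2 * θ 0 := by
  have hle : ∀ i j, i ≤ j → j ≤ t → θ j ≤ θ i := fun i j hij hj => by
    rcases hij.eq_or_lt with rfl | h
    · exact le_rfl
    · exact (hθ i j h hj).le
  have hpos' : ∀ j ≤ t, 0 < θ j := fun j hj => hpos.trans_le (hle j t hj le_rfl)
  have hsplit : ∀ x, ∑ j ∈ Finset.range (t + 1),
      ((if j = 0 then 1 else 0) - μ j) * θ j / (x - θ j)
      = θ 0 / (x - θ 0) - ∑ j ∈ Finset.range (t + 1), μ j * (θ j / (x - θ j)) := by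
    intro x
    simp only [sub_mul, sub_div, Finset.sum_sub_distrib, mul_div_assoc]
    congr 1
    simp
  -- `t + 2` sample points for degree `t + 1`; `2θ_0` takes the place of `θ_0`.
  let b : ℕ → ℝ := fun j => if j = 0 then 2 * θ 0 else if j ≤ t then θ j else θ t / 2
  have hb0 : b 0 = 2 * θ 0 := rfl
  have hbt : b (t + 1) = θ t / 2 := by simp [b]
  have hbj : ∀ j, 1 ≤ j → j ≤ t → b j = θ j := fun j h1 h2 => by
    simp only [b]; rw [if_neg (by omega), if_pos h2]
  have hb : ∀ j < t + 1, b (j + 1) < b j := by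
    intro j hj
    rcases Nat.eq_zero_or_pos j with rfl | h0
    · rw [hb0, hbj _ le_rfl ht]
      linarith [hθ 0 1 one_pos ht, hpos' 0 (Nat.zero_le _)]
    · rcases Nat.lt_or_ge j t with h | h
      · rw [hbj _ (by omega) h, hbj _ h0 h.le]
        exact hθ j (j + 1) (by omega) h
      · obtain rfl : j = t := by omega
        rw [hbt, hbj _ h0 le_rfl]
        linarith
  have hsgn : ∀ j ≤ t + 1, 0 < (-1 : ℝ) ^ j * p.eval (b j) := by
    intro j hj
    rcases Nat.eq_zero_or_pos j with rfl | h0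
    · have hlt : ∀ j ∈ Finset.range (t + 1), 0 < 2 * θ 0 - θ j := fun j hj => by
        rw [Finset.mem_range] at hj
        linarith [hle 0 j (Nat.zero_le _) (by omega), hpos' 0 (Nat.zero_le _)]
      rw [hb0, hp _ fun j hj => (sub_pos.1 (hlt j hj)).ne', hsplit, pow_zero, one_mul]
      refine mul_pos (Finset.prod_pos hlt) ?_
      have h0' := (hpos' 0 (Nat.zero_le _)).ne'
      rw [show 2 * θ 0 - θ 0 = θ 0 by ring, div_self h0']
      have : 0 < ∑ j ∈ Finset.range (t + 1), μ j * (θ j / (2 * θ 0 - θ j)) := by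
        refine Finset.sum_pos (fun j hj => ?_) (by simp)
        have hj' : j ≤ t := by rw [Finset.mem_range] at hj; omega
        exact mul_pos (hμ j hj') (div_pos (hpos' j hj') (hlt j hj))
      linarith
    · rcases Nat.lt_or_ge t j with h | h
      · obtain rfl : j = t + 1 := by omega
        have hlt : ∀ j < t + 1, θ t / 2 < θ j := fun j hj => by
          linarith [hle j t (by omega) le_rfl]
        rw [hbt, hp _ fun j hj => (hlt j (Finset.mem_range.1 hj)).ne, hsplit, ← mul_assoc]
        refine mul_pos (neg_one_pow_mul_prod_sub_pos hlt) ?_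
        -- The secular factor is `1 - θ_0/(θ_t/2 - θ_0)` plus a `μ`-average of terms at least `-2`,
        -- hence exceeds `1 + 1 - 2 = 0`.
        have h1 : θ 0 / (θ t / 2 - θ 0) < -1 := by
          have := hlt 0 (by omega)
          rw [div_lt_iff_of_neg (by linarith)]
          linarith
        have h2 : -2 ≤ ∑ j ∈ Finset.range (t + 1), μ j * (θ j / (θ t / 2 - θ j)) := by
          calc (-2 : ℝ) = ∑ j ∈ Finset.range (t + 1), μ j * (-2) := by
                rw [← Finset.sum_mul, hsum, one_mul]
            _ ≤ _ := by
                refine Finset.sum_le_sum fun j hj => ?_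
                rw [Finset.mem_range] at hj
                refine mul_le_mul_of_nonneg_left ?_ (hμ j (by omega)).le
                rw [le_div_iff_of_neg (by linarith [hlt j hj])]
                linarith [hle j t (by omega) le_rfl]
        linarith
      · have hj' : j ∈ Finset.range (t + 1) := Finset.mem_range.2 (by omega)
        rw [hbj j h0 h, eval_secular_pole hp hj', if_neg (by omega)]
        -- At `θ_j` with `j ≥ 1` the value is `μ_j θ_j ∏ (θ_j - θ_i)`, whose negative factors are
        -- the `j` ones with `i < j`.
        have hprod : ∏ i ∈ (Finset.range (t + 1)).erase j, (θ j - θ i)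
            = (∏ i ∈ Finset.range j, (θ j - θ i)) * ∏ i ∈ Finset.Ico (j + 1) (t + 1),
              (θ j - θ i) := by
          rw [← Finset.prod_union]
          · refine Finset.prod_congr ?_ fun _ _ => rfl
            ext i
            simp only [Finset.mem_erase, Finset.mem_range, Finset.mem_union, Finset.mem_Ico]
            omega
          · rw [Finset.disjoint_left]
            intro i
            simp only [Finset.mem_range, Finset.mem_Ico]
            omega
        have h1 := neg_one_pow_mul_prod_sub_pos (m := j) (θ := θ) (x := θ j)
          fun i hi => hθ i j hi h
        have h2 : 0 < ∏ i ∈ Finset.Ico (j + 1) (t + 1), (θ j - θ i) :=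
          Finset.prod_pos fun i hi => by
            rw [Finset.mem_Ico] at hi
            exact sub_pos.2 (hθ j i (by omega) (by omega))
        rw [hprod]
        have h3 := mul_pos (mul_pos (hμ j h) (hpos' j h)) (mul_pos h1 h2)
        linarith
  obtain ⟨ρ, h1, h2, h3⟩ := exists_roots_of_alternating hm hd b hb hsgn
  exact ⟨ρ, h1, h2, fun i => by simpa only [hbt, hb0] using h3 i⟩

end SecularEquation

/-! ### Monotonicity and growth of `θ_j`. -/

section Asymptotics

variable {v t k : ℕ}

lemma theta_pos (ht : 1 ≤ t) (hk : 2 * t ≤ k) (hv : k + t ≤ v) {j : ℕ} (hj : j ≤ t) :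
    0 < theta v t k j := by
  rw [theta_eq hk (by omega) hj]
  have h1 : 0 < (k - j).choose (t - j) := Nat.choose_pos (by omega)
  have h2 : 0 < (v - t - j).choose (k - t) := Nat.choose_pos (by omega)
  positivity

lemma theta_succ_lt (ht : 1 ≤ t) (hk : 2 * t ≤ k) (hv : k + t ≤ v) {i : ℕ} (hi : i + 1 ≤ t) :
    theta v t k (i + 1) < theta v t k i := by
  rw [theta_eq hk (by omega) hi, theta_eq hk (by omega) (by omega)]
  have h1 : (k - (i + 1)).choose (t - (i + 1)) < (k - i).choose (t - i) := by
    rw [show k - i = k - (i + 1) + 1 by omega, show t - i = t - (i + 1) + 1 by omega,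
      Nat.choose_succ_succ']
    exact Nat.lt_add_of_pos_right (Nat.choose_pos (by omega))
  have h2 : (v - t - (i + 1)).choose (k - t) ≤ (v - t - i).choose (k - t) :=
    Nat.choose_le_choose _ (by omega)
  have h3 : 0 < (v - t - i).choose (k - t) := Nat.choose_pos (by omega)
  exact_mod_cast Nat.mul_lt_mul_of_lt_of_le h1 h2 h3

lemma theta_lt_theta (ht : 1 ≤ t) (hk : 2 * t ≤ k) (hv : k + t ≤ v) {i j : ℕ} (hij : i < j)
    (hj : j ≤ t) : theta v t k j < theta v t k i := by
  induction j, hij using Nat.le_induction with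
  | base => exact theta_succ_lt ht hk hv hj
  | succ j hij ih => exact (theta_succ_lt ht hk hv hj).trans (ih (by omega))

lemma theta_zero_le (hk : 2 * t ≤ k) (hv : k ≤ v) :
    theta v t k 0 ≤ (k.choose t : ℝ) * (v : ℝ) ^ (k - t) := by
  rw [theta_eq hk hv (Nat.zero_le t)]
  have h1 : (v - t - 0).choose (k - t) ≤ v ^ (k - t) :=
    (Nat.choose_le_pow _ _).trans (Nat.pow_le_pow_left (by omega) _)
  exact mul_le_mul_of_nonneg_left (by exact_mod_cast h1) (Nat.cast_nonneg _)

lemma le_theta_self (hk : 2 * t ≤ k) (hv : 2 * (k + t) ≤ v) :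
    (v : ℝ) ^ (k - t) / (2 ^ (k - t) * (k - t).factorial) ≤ theta v t k t := by
  rw [theta_eq hk (by omega) le_rfl, Nat.sub_self, Nat.choose_zero_right, Nat.cast_one, one_mul]
  refine le_trans ?_ (Nat.pow_le_choose (k - t) (v - t - t))
  rw [← div_div, ← div_pow]
  gcongr
  -- The base of the power bound is `v - t - k + 1`, at least `v/2` once `v ≥ 2(k + t)`.
  have h : v ≤ 2 * (v - t - t + 1 - (k - t)) := by omega
  have h' : (v : ℝ) ≤ 2 * ((v - t - t + 1 - (k - t) : ℕ) : ℝ) := by exact_mod_cast h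
  linarith

end Asymptotics

/-! ### Eigenvalues of `R` and `M₁`. -/

section Spectrum

variable {v t k : ℕ}

lemma exists_roots_matR (ht : 1 ≤ t) (hk : 2 * t ≤ k) (hv : k + t ≤ v) (T₀ : TSet v t) :
    ∃ ρ : Fin (t + 1) → ℝ, StrictMono ρ ∧ (matR k T₀).charpoly = ∏ i, (X - C (ρ i)) ∧
      ∀ i, theta v t k t / 2 < ρ i ∧ ρ i < 2 * theta v t k 0 := by
  have hv' : 2 * t ≤ v := by omega
  have hn : (0 : ℝ) < v.choose t := by exact_mod_cast Nat.choose_pos (by omega)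
  refine exists_roots_of_secular (μ := fun j => (mult v j : ℝ) / v.choose t) ht
    (fun i j hij hj => theta_lt_theta ht hk hv hij hj) (theta_pos ht hk hv le_rfl)
    (fun j hj => div_pos (Nat.cast_pos.2 (mult_pos (by omega))) hn) ?_
    (Matrix.charpoly_monic _) ?_ fun x hx => ?_
  · rw [← Finset.sum_div, div_eq_one_iff_eq hn.ne']
    exact_mod_cast sum_mult hv'
  · rw [Matrix.charpoly_natDegree_eq_dim, Fintype.card_fin]
  · rw [eval_charpoly_matR ht hv' T₀ x fun j => hx j (Finset.mem_range.2 j.2), Finset.prod_range,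
      Finset.sum_range]
    simp only [weight, Fin.val_eq_zero_iff]

lemma eigenvalue_covM₁ (ht : 1 ≤ t) (hk : 2 * t ≤ k) (hv : k + t ≤ v) (T₀ : TSet v t) {z : ℂ}
    (hz : Module.End.HasEigenvalue
      (Matrix.toLin' ((covM₁ k T₀).map (algebraMap ℝ ℂ))) z) :
    ∃ x : ℝ, z = (x : ℂ) ∧ theta v t k t / 2 < x ∧ x < 2 * theta v t k 0 := by
  obtain ⟨ρ, -, hρ, hb⟩ := exists_roots_matR ht hk hv T₀
  have hroot := (Module.End.hasEigenvalue_iff_isRoot_charpoly _ _).1 hz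
  rw [Matrix.charpoly_toLin', Matrix.charpoly_map, charpoly_covM₁ ht (by omega), hρ, IsRoot.def,
    Polynomial.map_mul, Polynomial.map_prod, Polynomial.map_prod, eval_mul, eval_prod, eval_prod,
    mul_eq_zero, Finset.prod_eq_zero_iff, Finset.prod_eq_zero_iff] at hroot
  simp only [Polynomial.map_pow, Polynomial.map_sub, map_X, map_C, eval_pow, eval_sub, eval_X,
    eval_C] at hroot
  rcases hroot with ⟨i, -, hi⟩ | ⟨j, hj, hj0⟩
  · exact ⟨ρ i, sub_eq_zero.1 hi, hb i⟩
  · rw [Finset.mem_Icc] at hj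
    have h0 := theta_lt_theta ht hk hv (show 0 < j by omega) hj.2
    have hjpos := theta_pos ht hk hv hj.2
    refine ⟨theta v t k j, sub_eq_zero.1 (eq_zero_of_pow_eq_zero hj0), ?_, by linarith⟩
    rcases hj.2.eq_or_lt with rfl | hlt
    · linarith
    · linarith [theta_lt_theta ht hk hv hlt le_rfl]

end Spectrum

end JohnsonCoverage

open JohnsonCoverage in
theorem proposition5p1 (t k : ℕ) (ht : 1 ≤ t) (hk : 2 * t ≤ k) :
    -- structure of `R` and factorization of the characteristic polynomial of `M₁`
    (∀ v : ℕ, k ≤ v → ∀ T₀ : TSet v t,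
      (covM₁ k T₀).charpoly
          = (matR k T₀).charpoly
            * ∏ j ∈ Finset.Icc 1 t, (X - C (theta v t k j)) ^ (mult v j - 1) ∧
      matR k T₀
          = matTheta v t k * (1 + Matrix.vecMulVec
              (fun i : Fin (t + 1) =>
                (if i = 0 then 1 else 0) - √(mult v i : ℝ) / (v.choose t : ℝ))
              (fun j : Fin (t + 1) => √(mult v j : ℝ))) ∧
      (matR k T₀ - matTheta v t k).rank = 1) ∧
    -- location and order of the eigenvalues, for all large `v`
    (∃ (v₀ : ℕ) (c c' : ℝ), 0 < c ∧ 0 < c' ∧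
      ∀ v : ℕ, v₀ ≤ v → k ≤ v → ∀ T₀ : TSet v t,
        (∃ ρ : Fin (t + 1) → ℝ, StrictMono ρ ∧
          (matR k T₀).charpoly = ∏ i, (X - C (ρ i)) ∧
          ∀ i, theta v t k t / 2 < ρ i) ∧
        (∀ z : ℂ,
          Module.End.HasEigenvalue
              (Matrix.toLin' ((covM₁ k T₀).map (algebraMap ℝ ℂ))) z →
          ∃ x : ℝ, z = (x : ℂ) ∧ theta v t k t / 2 < x ∧
            c * (v : ℝ) ^ (k - t) ≤ x ∧ x ≤ c' * (v : ℝ) ^ (k - t))) := by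
  refine ⟨fun v hv T₀ => ⟨charpoly_covM₁ ht (hk.trans hv) T₀, matR_eq ht (hk.trans hv) T₀,
    rank_matR_sub_matTheta ht hk hv T₀⟩, 2 * (k + t),
    -- These constants come from `θ_t/2 < λ < 2θ_0` and the bounds on `θ_t` and `θ_0`.
    (2 ^ (k - t) * (k - t).factorial : ℝ)⁻¹ / 2, 2 * k.choose t, by positivity,
    mul_pos two_pos (Nat.cast_pos.2 (Nat.choose_pos (by omega))),
    fun v hv₀ hv T₀ => ⟨?_, fun z hz => ?_⟩⟩
  · obtain ⟨ρ, h1, h2, h3⟩ := exists_roots_matR ht hk (by omega) T₀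
    exact ⟨ρ, h1, h2, fun i => (h3 i).1⟩
  · obtain ⟨x, h1, h2, h3⟩ := eigenvalue_covM₁ ht hk (by omega) T₀ hz
    have h4 := theta_zero_le hk hv
    have h5 := le_theta_self hk hv₀
    rw [div_eq_inv_mul] at h5
    exact ⟨x, h1, h2, by linarith, by linarith⟩
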